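/- **Setting.** Let $\mathcal L=\{<,\dots\}$ be a countable first-order language, $\theta$ a strongly inaccessible (in particular uncountable) cardinal. Let $\mathcal L^S$ be the Skolem language of $\mathcal L$ (add, $\omega$ times, a Skolem function symbol for every formula with a distinguished variable), and let $M$ be an $\mathcal L^S$-structure satisfying the Skolem theory $T_{\mathrm{skolem}}$, in which $<$ is a linear order that is $\theta$-like: $|M|=\theta$ and every proper initial segment has cardinality $<\theta$. Let $M=\bigcup_{i<\theta}M_i$, where $\langle M_i\rangle_{i<\theta}$ is a continuous chain of elementary $\mathcal L^S$-submodels of $M$ such that $M_j$ is an end extension of $M_i$ for $i<j<\theta$, and put $F(a)=\min\{i<\theta: a\in M_i\}$ for $a\in M$. Let $r,s$ be positive integers. For a set $X\subset M$, $[X]^r$ is the set of strictly increasing $r$-sequences from $X$ and, for a cardinal $\mu$, $[X]^\mu$ is the set of subsets of $X$ of cardinality $\mu$. $[F]^{r,s}$ is the set of all $\mathbf a=\langle\langle a_{11},\dots,a_{1r}\rangle,\dots,\langle a_{s1},\dots,a_{sr}\rangle\rangle$ whose rows are in $[M]^r$, with $F(a_{ij})=F(a_{il})$ for all $i,j,l$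 and $F(a_{11})<F(a_{21})<\dots<F(a_{s1})$. For $A\subset M$, $[F|A]^{r,s}$ is the set of those $\mathbf a\in[F]^{r,s}$ with all entries in $A$; $[F|A]^{r,0}$ consists of the empty tuple only. **Superlarge sets.** Let $1\le e\le s$ and $S\subset[F]^{r,s}$. In the game $G(S,e)$ player I chooses a cardinal $\mu_1<\theta$, player II an ordinal $\beta_1<\theta$, then I chooses $\mu_2<\theta$, II chooses $\beta_2<\theta$, and so on; after I's $e$-th move $\mu_e<\theta$, II's $e$-th and last move is a sequence $\langle\beta_{e+i}\rangle_{i<\theta}$ of ordinals $<\theta$. Player II wins if $\beta_1<\beta_2<\dots<\beta_e<\dots<\beta_{e+i}<\cdots$ $(i<\theta)$ and there are sets $X_k\in[F^{-1}(\beta_k)]^{\mu_k}$ $(1\le k\le e)$ and $X_{e+i}\subset F^{-1}(\beta_{e+i})$ $(1\le i<\theta)$ with $\sup\{|X_{e+i}|:1\le i<\theta\}=\theta$ and $$\prod_{1\le k\le e}[X_k]^r\times\Big[F\,\Big|\bigcup_{1\le i<\theta}X_{e+i}\Big]^{r,s-e}\subset S .$$ $S$ is *$e$-superlarge* if II has a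 winning strategy in $G(S,e)$. **Sentences.** Let $C^*=\{c_{ij}: i,j<\omega\}$ be new constants, ordered lexicographically by their indices. A sentence $\sigma$ of $\mathcal L^S(C^*)$ is *of type $\Sigma_1^*$(iv)*, with $\iota(\sigma)=i_n$, if it has the form $$\tau(c_{i_1j_1},\dots,c_{i_nj_n})<c_{(i_n-1)j}\ \longrightarrow\ \tau(c_{i_1j_1},\dots,c_{i_nj_n})=\tau(c_{i_1j_1},\dots,c_{i_qj_q},c_{ul_1},\dots,c_{ul_{n-q}}),$$ where $n\ge1$, $\tau(v_1,\dots,v_n)$ is a term of $\mathcal L^S$, $i_n>1$, $u\ge i_n$, $q$ is the greatest index with $i_q\ne i_n$ ($q=0$ if there is none), and both displayed sequences of constants, $c_{i_1j_1},\dots,c_{i_nj_n}$ and $c_{i_1j_1},\dots,c_{i_qj_q},c_{ul_1},\dots,c_{ul_{n-q}}$, are strictly increasing. If all $c_{ij}$ occurring in $\sigma$ have $1\le i\le s$, $1\le j\le r$, and $\mathbf a\in[F]^{r,s}$, then $M\models\sigma(\mathbf a)$ means that $\sigma$ holds in $M$ with each $c_{ij}$ interpreted as $a_{ij}$. **Proposition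 3.4.** Let $S\subset[F]^{r,s}$ be $e$-superlarge, $1\le e<s$. Let $\sigma_1,\dots,\sigma_p$ be finitely many sentences of type $\Sigma_1^*$(iv) such that all $c_{ij}$ occurring in them satisfy $1\le i\le s$ and $1\le j\le r$, and such that $\iota(\sigma_1)=\dots=\iota(\sigma_p)=e'$ with $e<e'\le s$. Then there is an $e'$-superlarge set $S'\subset S$ such that $M\models\sigma_1(\mathbf a)\wedge\dots\wedge\sigma_p(\mathbf a)$ for every $\mathbf a\in S'$. -/

import Mathlib

open Cardinal Ordinal Order

universe u w

namespace Superlarge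

/-! ### The Skolem language and the Skolem theory -/

/-- Finite stages of the Skolemization of `L`: stage `0` is `L`, and stage `k + 1` adds to stage `k`
an `n`-ary function symbol for every formula `φ(x₀, …, xₙ₋₁, y)` of stage `k`. -/
def skolemStage (L : FirstOrder.Language.{u, u}) : ℕ → FirstOrder.Language.{u, u}
  | 0 => L
  | k + 1 => (skolemStage L k).sum (skolemStage L k).skolem₁

/-- The Skolem language `L^S` of `L`, the union of all stages: its function symbols are those of `L`
together with one Skolem function symbol for every formula of every stage; its relation symbols are
those of `L`. -/
def skolemLanguage (L : FirstOrder.Language.{u, u}) : FirstOrder.Language.{u, u} where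
  Functions n := L.Functions n ⊕ Σ k : ℕ, (skolemStage L k).BoundedFormula Empty (n + 1)
  Relations n := L.Relations n

/-- A relation symbol of `L` as a relation symbol of `L^S`. -/
def relSymbol (L : FirstOrder.Language.{u, u}) {n : ℕ} (R : L.Relations n) :
    (skolemLanguage L).Relations n := R

/-- The inclusion of the `k`-th stage in `L^S`. -/
def stageHom (L : FirstOrder.Language.{u, u}) : ∀ k : ℕ, skolemStage L k →ᴸ skolemLanguage L
  | 0 => ⟨fun _ f => Sum.inl f, fun _ R => R⟩
  | k + 1 => (stageHom L k).sumElim ⟨fun _ φ => Sum.inr ⟨k, φ⟩, fun _ R => R.elim⟩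

/-- The Skolem function symbol of the formula `φ(x₀, …, xₙ₋₁, y)`. -/
def skolemSymbol (L : FirstOrder.Language.{u, u}) {k n : ℕ}
    (φ : (skolemStage L k).BoundedFormula Empty (n + 1)) : (skolemLanguage L).Functions n :=
  Sum.inr ⟨k, φ⟩

/-- The Skolem axiom `∀ x̄ (∃ y φ(x̄, y) → ∃ y (φ(x̄, y) ∧ f_φ(x̄) = y))` of `φ(x̄, y)`. -/
def skolemAxiom (L : FirstOrder.Language.{u, u}) {k n : ℕ}
    (φ : (skolemStage L k).BoundedFormula Empty (n + 1)) : (skolemLanguage L).Sentence :=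
  ((((stageHom L k).onBoundedFormula φ).ex).imp
    (((stageHom L k).onBoundedFormula φ ⊓
      (FirstOrder.Language.Term.func (skolemSymbol L φ)
          (fun i : Fin n => FirstOrder.Language.Term.var (Sum.inr i.castSucc))).bdEqual
        (FirstOrder.Language.Term.var (Sum.inr (Fin.last n)))).ex)).alls

/-- The theory `T_skolem`. -/
def skolemTheory (L : FirstOrder.Language.{u, u}) : (skolemLanguage L).Theory :=
  {ψ | ∃ (k n : ℕ) (φ : (skolemStage L k).BoundedFormula Empty (n + 1)), ψ = skolemAxiom L φ}

/-! ### Sentences of type (iv) of the theory `Σ₁*` -/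

/-- A sentence of `L^S(C*)`, where `C* = {c_{ij} | i, j < ω}`; the constant `c_{ij}` is indexed by
the pair `(i, j)`. -/
abbrev CSentence (L : FirstOrder.Language.{u, u}) := ((skolemLanguage L).withConstants (ℕ × ℕ)).Sentence

/-- The (indices of the) constants `c_{ij}` occurring in a sentence of `L^S(C*)`: these are the
free variables after each constant has been turned into a variable. -/
def constantsIn {L : FirstOrder.Language.{u, u}} (σ : CSentence L) : Finset (ℕ × ℕ) :=
  (FirstOrder.Language.Formula.equivSentence.symm σ).freeVarFinset

/-- The data of a sentence of type (iv): a term `τ(v_1, …, v_n)` of `L^S` with `n ≥ 1` (here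
`n = m + 1`, and `v_1, …, v_n` are numbered from `0` to `m`), an increasing sequence of constants
`c_{i_1 j_1}, …, c_{i_n j_n}` with `i_n > 1`, an index `j`, an index `u ≥ i_n` and indices for the
new constants `c_{u l}`. -/
structure TypeIVData (L : FirstOrder.Language.{u, u}) where
  m : ℕ
  τ : (skolemLanguage L).Term (Fin (m + 1))
  /-- `c k = (i_k, j_k)` -/
  c : Fin (m + 1) → ℕ × ℕ
  j : ℕ
  u : ℕ
  /-- only the values at those `k` with `i_k = i_n` matter -/
  l : Fin (m + 1) → ℕ
  c_increasing : StrictMono fun k => toLex (c k)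
  one_lt : 1 < (c (Fin.last m)).1
  le_u : (c (Fin.last m)).1 ≤ u
  right_increasing :
    StrictMono fun k => toLex (if (c k).1 = (c (Fin.last m)).1 then (u, l k) else c k)

namespace TypeIVData

variable {L : FirstOrder.Language.{u, u}} (d : TypeIVData L)

/-- `ι = i_n` -/
def iota : ℕ := (d.c (Fin.last d.m)).1

/-- The constants on the right-hand side: `c_{i_k j_k}` is kept if `i_k ≠ i_n`, and replaced by
`c_{u l_k}` if `i_k = i_n`. -/
def right (k : Fin (d.m + 1)) : ℕ × ℕ := if (d.c k).1 = d.iota then (d.u, d.l k) else d.c k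

/-- The sentence `τ(c_{i_1 j_1}, …, c_{i_n j_n}) < c_{(i_n - 1) j} →
τ(c_{i_1 j_1}, …, c_{i_n j_n}) = τ(c̄, c_{u l_1}, …, c_{u l_{n - q}})`. -/
def sentence (lt : L.Relations 2) : CSentence L :=
  FirstOrder.Language.Formula.equivSentence
    (((relSymbol L lt).formula₂
        (d.τ.relabel d.c) (FirstOrder.Language.Term.var (d.iota - 1, d.j))).imp
      (FirstOrder.Language.Term.equal (d.τ.relabel d.c) (d.τ.relabel d.right)))

end TypeIVData

/-- `σ` is a sentence of type `Σ₁*`(iv) with `ι(σ) = e`. (`ι` is a function of `σ`, as the constant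
on the right of `<` in `σ` is `c_{(ι(σ) - 1) j}`.) -/
def IsTypeIV {L : FirstOrder.Language.{u, u}} (lt : L.Relations 2) (σ : CSentence L) (e : ℕ) : Prop :=
  ∃ d : TypeIVData L, d.sentence lt = σ ∧ d.iota = e

/-- `M ⊨ σ(𝐚)` for an `s × r` matrix `𝐚`: the sentence `σ` holds in `M` when every `c_{ij}` with
`1 ≤ i ≤ s`, `1 ≤ j ≤ r` is interpreted as `a_{ij}` (matrices are indexed from `0` here), no matter
how the other constants are interpreted. -/
def SatisfiesAt {L : FirstOrder.Language.{u, u}} {M : Type w} [(skolemLanguage L).Structure M] {r s : ℕ}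
    (σ : CSentence L) (a : Fin s → Fin r → M) : Prop :=
  ∀ v : ℕ × ℕ → M, (∀ (i : Fin s) (j : Fin r), v (i + 1, j + 1) = a i j) →
    letI := FirstOrder.Language.constantsOn.structure v
    FirstOrder.Language.Sentence.Realize M σ

/-! ### The model, its chain of submodels and the rank function `F` -/

/-- The linear order `M` is `θ`-like: it has cardinality `θ`, and every proper initial segment has
smaller cardinality. -/
def IsThetaLike (θ : Cardinal.{w}) (M : Type w) [LinearOrder M] : Prop :=
  #M = θ ∧ ∀ a : M, #(Set.Iio a) < θ

/-- `⟨N i | i < θ⟩` is a continuous chain of elementary submodels of `M` with union `M`, in which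
later members are end extensions of earlier ones. (Values `N i` for `i ≥ θ` are irrelevant.) -/
structure IsElementaryEndChain (θ : Cardinal.{w}) {K : FirstOrder.Language.{u, u}} {M : Type w}
    [LinearOrder M] [K.Structure M] (N : Ordinal.{w} → K.ElementarySubstructure M) : Prop where
  mono : ∀ i j, i < j → j < θ.ord → N i ≤ N j
  end_ext : ∀ i j, i < j → j < θ.ord → ∀ a ∈ N i, ∀ b ∈ N j, b ∉ N i → a < b
  continuous : ∀ i, IsSuccLimit i → i < θ.ord → ∀ a ∈ N i, ∃ j < i, a ∈ N j
  cover : ∀ a : M, ∃ i < θ.ord, a ∈ N i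

/-- `F(a)` is the least `i < θ` with `a ∈ N i`. -/
noncomputable def rankFn (θ : Cardinal.{w}) {K : FirstOrder.Language.{u, u}} {M : Type w} [K.Structure M]
    (N : Ordinal.{w} → K.ElementarySubstructure M) (a : M) : Ordinal.{w} :=
  sInf {i | i < θ.ord ∧ a ∈ N i}

/-! ### Matrices, the game and superlarge sets -/

section Game

variable {M : Type w} [LinearOrder M]

/-- `[X]^r`: the increasing `r`-sequences of elements of `X`. -/
def incSeq (X : Set M) (r : ℕ) : Set (Fin r → M) := {x | StrictMono x ∧ ∀ j, x j ∈ X}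

/-- `[F|A]^{r,s}`: the `s`-tuples of increasing `r`-sequences of elements of `A` such that `F` is
constant on each sequence and increases strictly from one sequence to the next. -/
def matricesOn (F : M → Ordinal.{w}) (A : Set M) (r s : ℕ) : Set (Fin s → Fin r → M) :=
  {x | (∀ i, x i ∈ incSeq A r) ∧ (∀ i j l, F (x i j) = F (x i l)) ∧
    ∀ i i', i < i' → ∀ j, F (x i j) < F (x i' j)}

/-- `[F]^{r,s}` -/
def matrices (F : M → Ordinal.{w}) (r s : ℕ) : Set (Fin s → Fin r → M) :=
  matricesOn F Set.univ r s

/-- `∏_{1 ≤ i ≤ e} [X_i]^r × [F|A]^{r,s-e}` for `e ≤ s`, as a set of `s`-tuples of `r`-sequences: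
the first `e` rows are in `[X_1]^r, …, [X_e]^r`, the other `s - e` rows form an element of
`[F|A]^{r,s-e}` (no condition if `s = e`). `X_i` is written `X k` with `k = i - 1 : Fin e`. -/
def winSet (F : M → Ordinal.{w}) {e : ℕ} (X : Fin e → Set M) (A : Set M) (r s : ℕ) :
    Set (Fin s → Fin r → M) :=
  {x | (∀ (i : Fin s) (h : (i : ℕ) < e), x i ∈ incSeq (X ⟨i, h⟩) r) ∧
    (fun k : Fin (s - e) => x ⟨e + k, by omega⟩) ∈ matricesOn F A r (s - e)}

/-- Player II wins the run of the game `G(S, e)` in which player I chose the cardinals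
`μ_1, …, μ_e` and player II chose the ordinals `β_1, …, β_e` (here `μ k`, `β k` with `k : Fin e`
numbered from `0`) and `β_{e+i}` for `1 ≤ i < θ` (here `γ i`; other values of `γ` are irrelevant).
Here `X k` stands for `X_{k+1}` and `Z i` for `X_{e+i}`. -/
def WinsII (θ : Cardinal.{w}) (F : M → Ordinal.{w}) {r s : ℕ} (S : Set (Fin s → Fin r → M))
    {e : ℕ} (μ : Fin e → Cardinal.{w}) (β : Fin e → Ordinal.{w})
    (γ : Ordinal.{w} → Ordinal.{w}) : Prop :=
  ((∀ k, β k < θ.ord) ∧ ∀ i, 1 ≤ i → i < θ.ord → γ i < θ.ord) ∧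
  (StrictMono β ∧ (∀ k i, 1 ≤ i → i < θ.ord → β k < γ i) ∧
    ∀ i j, 1 ≤ i → i < j → j < θ.ord → γ i < γ j) ∧
  ∃ (X : Fin e → Set M) (Z : Ordinal.{w} → Set M),
    (∀ k, X k ⊆ F ⁻¹' {β k} ∧ #(X k) = μ k) ∧
    (∀ i, 1 ≤ i → i < θ.ord → Z i ⊆ F ⁻¹' {γ i}) ∧
    IsLUB {κ : Cardinal.{w} | ∃ i, 1 ≤ i ∧ i < θ.ord ∧ κ = #(Z i)} θ ∧
    winSet F X (⋃ i ∈ {i : Ordinal.{w} | 1 ≤ i ∧ i < θ.ord}, Z i) r s ⊆ S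

/-- A strategy of player II in a game with `e` rounds: `head k` answers the cardinals
`μ_1, …, μ_{k+1}` by `β_{k+1}`, and `tail` answers `μ_1, …, μ_e` by the rest `⟨β_{e+i}⟩_{1 ≤ i < θ}`
of the last move (whose first ordinal `β_e` is given by `head`). -/
structure StrategyII (e : ℕ) where
  head : (k : Fin e) → (Set.Iic k → Cardinal.{w}) → Ordinal.{w}
  tail : (Fin e → Cardinal.{w}) → Ordinal.{w} → Ordinal.{w}

/-- The strategy `st` of player II wins every run of `G(S, e)` in which player I chooses
cardinals below `θ`. -/
def StrategyII.IsWinning (θ : Cardinal.{w}) (F : M → Ordinal.{w}) {r s : ℕ}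
    (S : Set (Fin s → Fin r → M)) {e : ℕ} (st : StrategyII.{w} e) : Prop :=
  ∀ μ : Fin e → Cardinal.{w}, (∀ k, μ k < θ) →
    WinsII θ F S μ (fun k => st.head k fun i => μ i) (st.tail μ)

/-- `S ⊆ [F]^{r,s}` is `e`-superlarge, `1 ≤ e ≤ s`. -/
structure IsSuperlarge (θ : Cardinal.{w}) (F : M → Ordinal.{w}) {r s : ℕ}
    (S : Set (Fin s → Fin r → M)) (e : ℕ) : Prop where
  one_le : 1 ≤ e
  le : e ≤ s
  subset : S ⊆ matrices F r s
  wins : ∃ st : StrategyII.{w} e, st.IsWinning θ F S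

end Game

end Superlarge

namespace Superlarge

/-! ### Partition relations below an inaccessible cardinal -/

/-! A sentence of type (iv) demands that a term value below an entry of row `e' - 1` survive the
exchange of row `e'` for a row `u ≥ e'`. Once the first `e' - 1` rows are confined to sets of size
below `θ`, `θ`-likeness leaves fewer than `θ` possible values below their entries. Colour a finite
set `t` by all triples (sentence, values of the earlier constants, value `b`) such that the term
takes the value `b` when `t` supplies its last row. As `θ` is a strong limit, there are fewer than
`θ` colours. If rows `e'` and `u` lie in homogeneous sets of the same colour, the sentence holds
(`isColourDetermined_satisfiesAt`).

Such sets are found in the tail of a run of the game. Erdős–Rado (`exists_isHomogeneous_le`) yields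
large homogeneous subsets of large tail sets, and regularity of `θ` makes one colour recur in every
size beyond every index (`exists_uniform_colour`). One such set then answers a further cardinal of
player I, and the others form the new tail (`WinsII.snoc`). The colouring may depend on the sets of
the earlier rounds, which are fixed by then. The rounds up to `e' - 1` are added with a trivial
colouring (`IsSuperlarge.of_le`), round `e'` with the one above. -/

theorem power_lt_of_isInaccessible {θ a b : Cardinal.{w}} (hθ : θ.IsInaccessible) (ha : a < θ)
    (hb : b < θ) : a ^ b < θ := by
  calc a ^ b ≤ (2 ^ a) ^ b := power_le_power_right (cantor a).le
    _ = 2 ^ (a * b) := power_mul.symm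
    _ < θ := hθ.isStrongLimit.isStrongPrelimit (mul_lt_of_lt hθ.isRegular.aleph0_le ha hb)

/-- The elements of `X` outside `B` which `f` does not distinguish from `x` over `B`. -/
def sameType {α C : Type w} [DecidableEq α] (f : Finset α → C) (X B : Set α) (x : α) : Set α :=
  {z | z ∈ X ∧ z ∉ B ∧ ∀ t : Finset α, ↑t ⊆ B → f (insert z t) = f (insert x t)}

open Classical in
/-- Greedy sequence in `X`, each term of which has the same type as `x` over the earlier terms. -/
noncomputable def typeSeq {α C ι : Type w} [LinearOrder ι] [WellFoundedLT ι] (f : Finset α → C)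
    (X : Set α) (x : α) : ι → α :=
  wellFounded_lt.fix fun i rec => Classical.epsilon (h := ⟨x⟩) fun z =>
    z ∈ sameType f X (Set.range fun j : Set.Iio i => rec j.1 j.2) x

open Classical in
theorem typeSeq_eq {α C ι : Type w} [LinearOrder ι] [WellFoundedLT ι] (f : Finset α → C)
    (X : Set α) (x : α) (i : ι) :
    typeSeq f X x i = Classical.epsilon (h := ⟨x⟩) fun z =>
      z ∈ sameType f X (Set.range fun j : Set.Iio i => typeSeq f X x j.1) x :=
  wellFounded_lt.fix_eq _ i

open Classical in
-- As long as `x` has not been chosen, `x` itself is a legitimate choice.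
theorem typeSeq_mem {α C ι : Type w} [LinearOrder ι] [WellFoundedLT ι] {f : Finset α → C}
    {X : Set α} {x : α} (hx : x ∈ X) (i : ι) (hi : ∀ j < i, typeSeq f X x j ≠ x) :
    typeSeq f X x i ∈ sameType f X (typeSeq f X x '' Set.Iio i) x := by
  have : typeSeq f X x i ∈
      sameType f X (Set.range fun j : Set.Iio i => typeSeq f X x j.1) x := by
    rw [typeSeq_eq f X x i]
    refine Classical.epsilon_spec (p := fun z => z ∈ sameType f X
      (Set.range fun j : Set.Iio i => typeSeq f X x j.1) x) ⟨x, hx, ?_, fun t _ => rfl⟩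
    rintro ⟨j, hj⟩
    exact hi j.1 j.2 hj
  rwa [Set.image_eq_range]

open Classical in
-- By induction the earlier terms agree, so both choices are made by the same choice function from
-- the same set. Thus the type of a point over its own sequence determines that sequence.
theorem typeSeq_congr {α C ι : Type w} [LinearOrder ι] [WellFoundedLT ι] {f : Finset α → C}
    {X : Set α} {x y : α}
    (h : ∀ t : Finset ι, f (insert x (t.image (typeSeq f X x))) =
      f (insert y (t.image (typeSeq f X y)))) (i : ι) :
    typeSeq f X x i = typeSeq f X y i := by
  induction i using WellFoundedLT.induction with
  | ind i ih =>
    have hB : (Set.range fun j : Set.Iio i => typeSeq f X x j.1) =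
        Set.range fun j : Set.Iio i => typeSeq f X y j.1 := by
      congr 1
      ext j
      exact ih j.1 j.2
    have hs : sameType f X (Set.range fun j : Set.Iio i => typeSeq f X x j.1) x =
        sameType f X (Set.range fun j : Set.Iio i => typeSeq f X y j.1) y := by
      rw [← hB]
      ext z
      refine and_congr_right fun _ => and_congr_right fun _ => forall₂_congr fun t ht => ?_
      rw [← Set.image_eq_range] at ht
      obtain ⟨t', ht', rfl⟩ := Finset.subset_set_image_iff.1 ht
      rw [h t']
      rw [Finset.image_congr (g := typeSeq f X y) fun j hj => ih j (ht' hj)]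
    rw [typeSeq_eq f X x i, typeSeq_eq f X y i, hs]

open Classical in
/-- In a sufficiently large set there is an end-homogeneous sequence. -/
theorem exists_endHomogeneous {α C ι : Type w} [LinearOrder ι] [WellFoundedLT ι]
    (f : Finset α → C) (X : Set α) (hX : #(ι × (Finset ι → C)) < #X) :
    ∃ (x : α) (a : ι → α), Function.Injective a ∧ (∀ i, a i ∈ X) ∧
      ∀ (i : ι) (t : Finset ι), (∀ j ∈ t, j < i) →
        f (insert (a i) (t.image a)) = f (insert x (t.image a)) := by
  by_cases H : ∃ x ∈ X, ∀ i : ι, typeSeq f X x i ≠ x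
  · obtain ⟨x, hx, hxi⟩ := H
    have key := fun i : ι => typeSeq_mem (f := f) hx i fun j _ => hxi j
    refine ⟨x, typeSeq f X x, ?_, fun i => (key i).1, fun i t ht => (key i).2.2 _ ?_⟩
    · refine Function.Injective.of_lt_imp_ne fun i j hij h => (key j).2.1 ⟨i, hij, h⟩
    · rw [Finset.coe_image]
      exact Set.image_mono fun j hj => ht j hj
  -- If every `x` appears in its own sequence, then its position together with its type over the
  -- sequence determines `x`, so `X` is too small.
  · push Not at H
    choose g hg using H
    refine absurd hX (not_lt.2 (mk_le_of_injective (f := fun x : X =>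
      (g x.1 x.2, fun t : Finset ι => f (insert x.1 (t.image (typeSeq f X x.1))))) ?_))
    rintro ⟨x, hx⟩ ⟨y, hy⟩ hxy
    simp only [Prod.mk.injEq] at hxy
    have := typeSeq_congr (fun t => congrFun hxy.2 t) (g x hx)
    rw [hg x hx, hxy.1, hg y hy] at this
    exact Subtype.ext this

/-- `f` is constant, with value `c`, on the `n`-element subsets of `Y`. -/
def IsHomogeneous {α C : Type w} (f : Finset α → C) (Y : Set α) (n : ℕ) (c : C) : Prop :=
  ∀ s : Finset α, ↑s ⊆ Y → s.card = n → f s = c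

theorem IsHomogeneous.mono {α C : Type w} {f : Finset α → C} {Y Y' : Set α} {n : ℕ} {c : C}
    (h : IsHomogeneous f Y n c) (hY : Y' ⊆ Y) : IsHomogeneous f Y' n c :=
  fun s hs hn => h s (hs.trans hY) hn

open Classical in
/-- The Erdős–Rado theorem, below an inaccessible cardinal. -/
theorem exists_isHomogeneous {θ : Cardinal.{w}} (hθ : θ.IsInaccessible) (n : ℕ)
    {κ μ : Cardinal.{w}} (hκ : κ < θ) (hμ : μ < θ) :
    ∃ ν < θ, ∀ (α C : Type w) (f : Finset α → C) (X : Set α), #C ≤ κ → ν ≤ #X →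
      ∃ Y ⊆ X, μ ≤ #Y ∧ ∃ c, IsHomogeneous f Y n c := by
  induction n with
  | zero =>
    refine ⟨μ, hμ, fun α C f X _ hX => ⟨X, subset_rfl, hX, f ∅, fun s _ hs => ?_⟩⟩
    rw [Finset.card_eq_zero.1 hs]
  | succ n ih =>
    obtain ⟨ν, hν, H⟩ := ih
    set ρ : Cardinal := max ν ℵ₀
    have hρ : ρ < θ := max_lt hν hθ.aleph0_lt
    refine ⟨succ (ρ * κ ^ ρ), hθ.isSuccLimit.succ_lt (mul_lt_of_lt hθ.isRegular.aleph0_le hρ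
      (power_lt_of_isInaccessible hθ hκ hρ)), fun α C f X hC hX => ?_⟩
    let ι := ρ.ord.ToType
    have hι : #ι = ρ := by simp [ι]
    have : Infinite ι := Cardinal.infinite_iff.2 (hι ▸ le_max_right _ _)
    obtain ⟨x, a, ha, haX, hend⟩ := exists_endHomogeneous (ι := ι) f X (by
      refine lt_of_lt_of_le (lt_succ_of_le ?_) hX
      rw [mk_prod, Cardinal.lift_id, Cardinal.lift_id, ← power_def, mk_finset_of_infinite, hι]
      gcongr
      exact power_le_power_right hC)
    obtain ⟨Y, hYX, hY, c, hc⟩ := H α C (fun t => f (insert x t)) (Set.range a) hC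
      -- The point `x` acts as a common top element: on subsets of the sequence, `f` at size `n + 1`
      -- is the colouring `t ↦ f (insert x t)` at size `n`.
      (by rw [mk_range_eq a ha, hι]; exact le_max_left _ _)
    refine ⟨Y, fun y hy => ?_, hY, c, fun s hs hn => ?_⟩
    · obtain ⟨i, rfl⟩ := hYX hy
      exact haX i
    · have hsr : (s : Set α) ⊆ a '' Set.univ := by rw [Set.image_univ]; exact hs.trans hYX
      obtain ⟨t, -, rfl⟩ := Finset.subset_set_image_iff.1 hsr
      have hne : t.Nonempty := by
        rw [← Finset.card_pos, ← Finset.card_image_of_injective t ha, hn]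
        exact n.succ_pos
      have hins : insert (t.max' hne) (t.erase (t.max' hne)) = t :=
        Finset.insert_erase (t.max'_mem hne)
      have hcard : ((t.erase (t.max' hne)).image a).card = n := by
        rw [Finset.card_image_of_injective _ ha, Finset.card_erase_of_mem (t.max'_mem hne),
          ← Finset.card_image_of_injective t ha, hn, Nat.add_sub_cancel]
      rw [← hins, Finset.image_insert, hend]
      · refine hc _ (subset_trans ?_ hs) hcard
        exact Finset.coe_subset.2 (Finset.image_mono a (Finset.erase_subset _ _))
      · exact fun j hj => t.lt_max'_of_mem_erase_max' hne hj

/-- Homogeneity for all exponents up to `R` at once. -/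
theorem exists_isHomogeneous_le {θ : Cardinal.{w}} (hθ : θ.IsInaccessible) (R : ℕ)
    {κ μ : Cardinal.{w}} (hκ : κ < θ) (hμ : μ < θ) :
    ∃ ν < θ, ∀ (α C : Type w) (f : Finset α → C) (X : Set α), #C ≤ κ → ν ≤ #X →
      ∃ Y ⊆ X, μ ≤ #Y ∧ ∃ c : ℕ → C, ∀ n ≤ R, IsHomogeneous f Y n (c n) := by
  induction R generalizing μ with
  | zero =>
    refine ⟨μ, hμ, fun α C f X _ hX => ⟨X, subset_rfl, hX, fun _ => f ∅, fun n hn s _ hs => ?_⟩⟩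
    rw [Finset.card_eq_zero.1 (hs.trans (Nat.le_zero.1 hn))]
  | succ R ih =>
    obtain ⟨ν, hν, H⟩ := ih hμ
    obtain ⟨ν', hν', H'⟩ := exists_isHomogeneous hθ (R + 1) hκ hν
    refine ⟨ν', hν', fun α C f X hC hX => ?_⟩
    obtain ⟨Y, hYX, hY, c, hc⟩ := H' α C f X hC hX
    obtain ⟨Z, hZY, hZ, d, hd⟩ := H α C f Y hC hY
    refine ⟨Z, hZY.trans hYX, hZ, fun n => if n ≤ R then d n else c, fun n hn => ?_⟩
    dsimp only
    split_ifs with h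
    · exact hd n h
    · obtain rfl : n = R + 1 := by omega
      exact hc.mono hZY

/-- Regularity of `θ`, in the lifted form needed for suprema over `Set.Iio β`, which lives one
universe higher. -/
theorem lift_mk_Iio_lt_cof {θ : Cardinal.{w}} (hθ : θ.IsInaccessible) {β : Ordinal.{w}}
    (hβ : β < θ.ord) :
    Cardinal.lift.{w, w + 1} #(Set.Iio β) < (Ordinal.lift.{w + 1} θ.ord).cof := by
  rw [← lift_cof, hθ.isRegular.cof_ord, Cardinal.mk_Iio_ordinal, Cardinal.lift_lift,
    Cardinal.lift_lt]
  exact Cardinal.lt_ord.1 hβ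

/-! ### Fibres of the rank function -/

theorem rankFn_le {θ : Cardinal.{w}} {K : FirstOrder.Language.{u, u}} {M : Type w}
    [K.Structure M] {N : Ordinal.{w} → K.ElementarySubstructure M} {i : Ordinal.{w}}
    (hi : i < θ.ord) {a : M} (ha : a ∈ N i) : rankFn θ N a ≤ i :=
  csInf_le' (s := {i | i < θ.ord ∧ a ∈ N i}) ⟨hi, ha⟩

section Rank

variable {θ : Cardinal.{w}} {K : FirstOrder.Language.{u, u}} {M : Type w} [LinearOrder M]
  [K.Structure M] {N : Ordinal.{w} → K.ElementarySubstructure M}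

theorem rankFn_mem (hN : IsElementaryEndChain θ N) (a : M) :
    rankFn θ N a < θ.ord ∧ a ∈ N (rankFn θ N a) :=
  csInf_mem (s := {i | i < θ.ord ∧ a ∈ N i}) (hN.cover a)

/-- A fibre of the rank function is small unless its rank is the largest one. -/
theorem mk_fibre_lt_of_lt_rankFn (hM : IsThetaLike θ M) (hN : IsElementaryEndChain θ N)
    {β : Ordinal.{w}} {a : M} (ha : β < rankFn θ N a) : #(rankFn θ N ⁻¹' {β}) < θ := by
  refine (mk_le_mk_of_subset fun b hb => ?_).trans_lt (hM.2 a)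
  obtain rfl : rankFn θ N b = β := hb
  obtain ⟨hi, hai⟩ := rankFn_mem hN a
  obtain ⟨hj, hbj⟩ := rankFn_mem hN b
  exact hN.end_ext _ _ ha hi b hbj a hai fun h => (rankFn_le hj h).not_gt ha

/-- If there is a superlarge set, then all fibres of the rank function are small. -/
theorem mk_fibre_lt (hθ : θ.IsInaccessible) (hM : IsThetaLike θ M)
    (hN : IsElementaryEndChain θ N) {r s e : ℕ} {S : Set (Fin s → Fin r → M)}
    (hS : IsSuperlarge θ (rankFn θ N) S e) {β : Ordinal.{w}} (hβ : β < θ.ord) :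
    #(rankFn θ N ⁻¹' {β}) < θ := by
  by_contra hbig
  -- A fibre of size `θ` must be the last nonempty one. Let player I ask for more points than any
  -- earlier fibre has: the first answer is then at least `β`, and all tail sets, having larger
  -- rank, are empty.
  have hle : ∀ a, rankFn θ N a ≤ β := fun a => by
    by_contra! h
    exact hbig (mk_fibre_lt_of_lt_rankFn hM hN h)
  have hpos : ∀ i : Set.Iio β, #(rankFn θ N ⁻¹' {i.1}) < θ := by
    rintro ⟨i, hi⟩
    have : (rankFn θ N ⁻¹' {β}).Nonempty := by
      rw [Set.nonempty_iff_ne_empty]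
      intro h
      exact hbig (by rw [h, mk_eq_zero]; exact hθ.pos)
    obtain ⟨a, rfl⟩ := this
    exact mk_fibre_lt_of_lt_rankFn hM hN hi
  set κ := ⨆ i : Set.Iio β, #(rankFn θ N ⁻¹' {i.1})
  have hκ : κ < θ := by
    refine lift_iSup_lt_of_lt_cof_ord ?_ hpos
    rw [← lift_ord]
    exact lift_mk_Iio_lt_cof hθ hβ
  obtain ⟨st, hst⟩ := hS.wins
  obtain ⟨-, ⟨-, hβγ, -⟩, X, Z, hX, hZ, hlub, -⟩ := hst (fun _ => succ κ)
    (fun _ => hθ.isSuccLimit.succ_lt hκ)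
  let k : Fin e := ⟨0, hS.one_le⟩
  set b := st.head k fun _ => succ κ
  have hb : β ≤ b := by
    by_contra! h
    have h1 : #(rankFn θ N ⁻¹' {b}) ≤ κ := le_ciSup Cardinal.bddAbove_of_small
      (⟨b, h⟩ : Set.Iio β)
    have h2 := mk_le_mk_of_subset (hX k).1
    rw [(hX k).2] at h2
    exact (h2.trans h1).not_gt (lt_succ κ)
  have hub : (0 : Cardinal) ∈ upperBounds
      {κ : Cardinal.{w} | ∃ i, 1 ≤ i ∧ i < θ.ord ∧ κ = #(Z i)} := by
    rintro _ ⟨i, h1, hi, rfl⟩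
    rw [nonpos_iff_eq_zero, mk_eq_zero_iff]
    refine ⟨fun ⟨a, ha⟩ => (hle a).not_gt (hb.trans_lt ?_)⟩
    rw [show rankFn θ N a = st.tail _ i from hZ i h1 hi ha]
    exact hβγ k i h1 hi
  exact (hlub.2 hub).not_gt hθ.pos

end Rank

/-! ### Refining the tail of a run -/

/-- Sets of small size with unbounded sizes contain, beyond every index, arbitrarily large
homogeneous sets with one and the same colour. -/
theorem exists_uniform_colour {θ : Cardinal.{w}} (hθ : θ.IsInaccessible) {α C : Type w}
    (hC : #C < θ) (f : Finset α → C) (R : ℕ) {Z : Ordinal.{w} → Set α}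
    (hZ : ∀ i, 1 ≤ i → i < θ.ord → #(Z i) < θ)
    (hlub : IsLUB {κ : Cardinal.{w} | ∃ i, 1 ≤ i ∧ i < θ.ord ∧ κ = #(Z i)} θ) :
    ∃ c : ℕ → C, ∀ κ < θ, ∀ i₀ < θ.ord, ∃ i, i₀ < i ∧ i < θ.ord ∧
      ∃ Y ⊆ Z i, κ ≤ #Y ∧ ∀ n ≤ R, IsHomogeneous f Y n (c n) := by
  -- The sets up to `i₀` have sizes bounded below `θ` by regularity, so later sets must account for
  -- the supremum `θ`.
  have hlarge : ∀ κ < θ, ∀ i₀ < θ.ord, ∃ i, i₀ < i ∧ i < θ.ord ∧ κ ≤ #(Z i) := by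
    intro κ hκ i₀ hi₀
    by_contra! H
    -- `Z 0` is unconstrained, so its size is replaced by `0`.
    let g : Set.Iio (succ i₀) → Cardinal.{w} := fun i => if 1 ≤ i.1 then #(Z i.1) else 0
    have hg : ⨆ i, g i < θ := by
      refine lift_iSup_lt_of_lt_cof_ord ?_ fun i => ?_
      · rw [← lift_ord]
        exact lift_mk_Iio_lt_cof hθ ((isSuccLimit_ord hθ.isRegular.aleph0_le).succ_lt hi₀)
      · dsimp only [g]
        split_ifs with h
        · exact hZ i h ((lt_succ_iff.1 i.2).trans_lt hi₀)
        · exact hθ.pos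
    have hub : max κ (⨆ i, g i) ∈ upperBounds
        {κ : Cardinal.{w} | ∃ i, 1 ≤ i ∧ i < θ.ord ∧ κ = #(Z i)} := ?_
    · exact (hlub.2 hub).not_gt (max_lt hκ hg)
    rintro _ ⟨i, h1, hi, rfl⟩
    rcases le_or_gt i i₀ with h | h
    · refine le_max_of_le_right (le_trans ?_ (le_ciSup Cardinal.bddAbove_of_small
        (⟨i, lt_succ_iff.2 h⟩ : Set.Iio (succ i₀))))
      simp [g, h1]
    · exact le_max_of_le_left (H i h hi).le
  by_contra! H
  -- If every `c` fails, at some size `κ c` beyond some index `i c`, the suprema over all `c` stay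
  -- below `θ`, because there are fewer than `θ` functions `ℕ → C`. A homogeneous set beyond both
  -- suprema has some `c` as its colour and refutes the failure of that `c`.
  choose κ hκ i hi H using H
  have hCN : #(ℕ → C) < θ := by
    rw [mk_arrow]
    simpa using power_lt_of_isInaccessible hθ hC hθ.aleph0_lt
  have hκ' : ⨆ c, κ c < θ := iSup_lt_of_lt_cof_ord (by rwa [hθ.isRegular.cof_ord]) hκ
  have hi' : ⨆ c, i c < θ.ord := Ordinal.iSup_lt_of_lt_cof (by rwa [hθ.isRegular.cof_ord]) hi
  obtain ⟨ν, hν, hER⟩ := exists_isHomogeneous_le hθ R hC hκ'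
  obtain ⟨j, hj, hjθ, hjν⟩ := hlarge ν hν _ hi'
  obtain ⟨Y, hYZ, hY, c, hc⟩ := hER α C f (Z j) le_rfl hjν
  obtain ⟨n, hn, hbad⟩ := H c j ((le_ciSup Ordinal.bddAbove_of_small c).trans_lt hj) hjθ Y hYZ
    ((le_ciSup Cardinal.bddAbove_of_small c).trans hY)
  exact hbad (hc n hn)

/-- A property of pairs of a cardinal and an ordinal below `θ` that, for each cardinal, holds at
unboundedly many ordinals, holds along an increasing `θ`-sequence of ordinals. -/
theorem exists_increasing_sequence {θ : Cardinal.{w}} (hθ : θ.IsInaccessible)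
    {P : Cardinal.{w} → Ordinal.{w} → Prop}
    (hP : ∀ κ < θ, ∀ i₀ < θ.ord, ∃ i, i₀ < i ∧ i < θ.ord ∧ P κ i) {b : Ordinal.{w}}
    (hb : b < θ.ord) :
    ∃ g : Ordinal.{w} → Ordinal.{w}, (∀ ξ < θ.ord, b < g ξ ∧ g ξ < θ.ord ∧ P ξ.card (g ξ)) ∧
      ∀ ξ η, ξ < η → η < θ.ord → g ξ < g η := by
  choose! h hh using hP
  -- The cardinal requested at stage `ξ` is `ξ.card`; these are cofinal in `θ`.
  let g : Ordinal.{w} → Ordinal.{w} := wellFounded_lt.fix fun ξ rec =>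
    h ξ.card (max b (⨆ η : Set.Iio ξ, rec η.1 η.2))
  have hg : ∀ ξ, g ξ = h ξ.card (max b (⨆ η : Set.Iio ξ, g η.1)) := fun ξ =>
    wellFounded_lt.fix_eq _ ξ
  have key : ∀ ξ < θ.ord, max b (⨆ η : Set.Iio ξ, g η.1) < θ.ord ∧ g ξ < θ.ord := by
    intro ξ
    induction ξ using WellFoundedLT.induction with
    | ind ξ ih =>
      intro hξ
      have h1 : max b (⨆ η : Set.Iio ξ, g η.1) < θ.ord := by
        exact max_lt hb (Ordinal.lift_iSup_lt_of_lt_cof (lift_mk_Iio_lt_cof hθ hξ)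
          fun η => (ih η.1 η.2 (lt_trans η.2 hξ)).2)
      refine ⟨h1, ?_⟩
      rw [hg]
      exact (hh _ (Cardinal.lt_ord.1 hξ) _ h1).2.1
  have spec := fun ξ (hξ : ξ < θ.ord) => hh _ (Cardinal.lt_ord.1 hξ) _ (key ξ hξ).1
  simp only [← hg] at spec
  refine ⟨g, fun ξ hξ => ⟨(le_max_left _ _).trans_lt (spec ξ hξ).1, (spec ξ hξ).2⟩,
    fun ξ η hξη hη => lt_of_le_of_lt (le_max_of_le_right ?_) (spec η hη).1⟩
  exact le_ciSup (f := fun η' : Set.Iio η => g η'.1) Ordinal.bddAbove_of_small ⟨ξ, hξη⟩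

/-! ### Extending a run by one round -/

section Game

variable {M : Type w} [LinearOrder M]

theorem mem_winSet_iff {F : M → Ordinal.{w}} {e r s : ℕ} {X : Fin e → Set M} {A : Set M}
    {x : Fin s → Fin r → M} :
    x ∈ winSet F X A r s ↔ (∀ (i : Fin s) (h : (i : ℕ) < e), x i ∈ incSeq (X ⟨i, h⟩) r) ∧
      (∀ i : Fin s, e ≤ i → x i ∈ incSeq A r) ∧
      (∀ i : Fin s, e ≤ i → ∀ j l, F (x i j) = F (x i l)) ∧
      ∀ i i' : Fin s, e ≤ i → i < i' → ∀ j, F (x i j) < F (x i' j) := by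
  have hk : ∀ i : Fin s, e ≤ i → ∃ k : Fin (s - e), (⟨e + k, by omega⟩ : Fin s) = i := fun i hi =>
    ⟨⟨i - e, by omega⟩, Fin.ext (by simp; omega)⟩
  refine and_congr_right fun _ => ⟨fun ⟨h1, h2, h3⟩ => ⟨?_, ?_, ?_⟩,
    fun ⟨h1, h2, h3⟩ => ⟨fun k => ?_, fun k => ?_, fun k k' hkk' => ?_⟩⟩
  · intro i hi
    obtain ⟨k, rfl⟩ := hk i hi
    exact h1 k
  · intro i hi
    obtain ⟨k, rfl⟩ := hk i hi
    exact h2 k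
  · intro i i' hi hii'
    obtain ⟨k, rfl⟩ := hk i hi
    obtain ⟨k', rfl⟩ := hk i' (hi.trans hii'.le)
    exact h3 k k' (by simpa using hii')
  · exact h1 _ (Nat.le_add_right _ _)
  · exact h2 _ (Nat.le_add_right _ _)
  · exact h3 _ _ (Nat.le_add_right _ _) (by simpa using hkk')

/-- `S'` contains those elements of `S` whose first `e` rows lie in given small sets and whose
other rows are in homogeneous sets of the same colour, for some colouring with few colours. -/
def IsColourDetermined (θ : Cardinal.{w}) {r s : ℕ} (S S' : Set (Fin s → Fin r → M)) (e : ℕ) :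
    Prop :=
  ∀ X : Fin e → Set M, (∀ k, #(X k) < θ) →
    ∃ (C : Type w) (f : Finset M → C) (R : ℕ), #C < θ ∧ ∀ (c : ℕ → C), ∀ a ∈ S,
      (∀ (i : Fin s) (h : (i : ℕ) < e) (j : Fin r), a i j ∈ X ⟨i, h⟩) →
      (∀ i : Fin s, e ≤ i → ∃ Y : Set M, (∀ j, a i j ∈ Y) ∧ ∀ n ≤ R, IsHomogeneous f Y n (c n)) →
      a ∈ S'

/-- The earlier ordinals `β` are kept and the new one is drawn from the old tail. Hence the earlier
moves need no knowledge of the last cardinal, which is what makes this a strategy. -/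
theorem WinsII.snoc {θ : Cardinal.{w}} (hθ : θ.IsInaccessible) {F : M → Ordinal.{w}}
    (hF : ∀ β < θ.ord, #(F ⁻¹' {β}) < θ) {r s e : ℕ} (hr : 1 ≤ r)
    {S S' : Set (Fin s → Fin r → M)} (hS' : IsColourDetermined θ S S' e)
    {μ : Fin (e + 1) → Cardinal.{w}} (hμ : ∀ k, μ k < θ) {β : Fin e → Ordinal.{w}}
    {γ : Ordinal.{w} → Ordinal.{w}} (h : WinsII θ F S (fun k => μ k.castSucc) β γ) :
    ∃ (b : Ordinal.{w}) (γ' : Ordinal.{w} → Ordinal.{w}),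
      WinsII θ F S' μ (Fin.snoc (α := fun _ => Ordinal.{w}) β b) γ' := by
  obtain ⟨⟨hβθ, hγθ⟩, ⟨hβ, hβγ, hγ⟩, X, Z, hX, hZ, hlub, hsub⟩ := h
  obtain ⟨C, f, R, hC, hf⟩ := hS' X fun k => (hX k).2 ▸ hμ _
  have hZθ : ∀ i, 1 ≤ i → i < θ.ord → #(Z i) < θ := fun i h1 hi =>
    (mk_le_mk_of_subset (hZ i h1 hi)).trans_lt (hF _ (hγθ i h1 hi))
  obtain ⟨c, hc⟩ := exists_uniform_colour hθ hC f R hZθ hlub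
  have h1θ : (1 : Ordinal.{w}) < θ.ord := by
    rw [Cardinal.lt_ord, card_one]
    exact_mod_cast hθ.nat_lt 1
  -- Searching beyond index `1` keeps all chosen indices in the range where `Z` and `γ` are
  -- constrained. Here `b` is an index of the old tail; the ordinal played is `γ b`.
  obtain ⟨b, hb1, hbθ, Yb, hYb, hμb, hYbc⟩ := hc (μ (Fin.last e)) (hμ _) 1 h1θ
  obtain ⟨Y, hYYb, hY⟩ := Cardinal.le_mk_iff_exists_subset.1 hμb
  obtain ⟨g, hg, hgmono⟩ := exists_increasing_sequence hθ hc hbθ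
  choose! W hW using fun ξ hξ => (hg ξ hξ).2.2
  have hg1 : ∀ ξ < θ.ord, 1 ≤ g ξ := fun ξ hξ => hb1.le.trans (hg ξ hξ).1.le
  have hWF : ∀ ξ < θ.ord, W ξ ⊆ F ⁻¹' {γ (g ξ)} := fun ξ hξ =>
    (hW ξ hξ).1.trans (hZ _ (hg1 ξ hξ) (hg ξ hξ).2.1)
  have hYF : Y ⊆ F ⁻¹' {γ b} := (hYYb.trans hYb).trans (hZ b hb1.le hbθ)
  have hγg : ∀ ξ η, ξ < η → η < θ.ord → γ (g ξ) < γ (g η) := fun ξ η hξη hη =>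
    hγ _ _ (hg1 ξ (hξη.trans hη)) (hgmono ξ η hξη hη) (hg η hη).2.1
  refine ⟨γ b, fun ξ => γ (g ξ), ⟨fun k => ?_, fun ξ _ hξ => hγθ _ (hg1 ξ hξ) (hg ξ hξ).2.1⟩,
    ⟨fun k k' hkk' => ?_, fun k ξ _ hξ => ?_, fun ξ η _ => hγg ξ η⟩,
    Fin.snoc (α := fun _ => Set M) X Y, W, fun k => ?_, fun ξ _ => hWF ξ, ⟨?_, fun u hu => ?_⟩, ?_⟩
  · cases k using Fin.lastCases with
    | last => simpa using hγθ b hb1.le hbθ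
    | cast k => simpa using hβθ k
  · cases k' using Fin.lastCases with
    | last =>
      cases k using Fin.lastCases with
      | last => exact absurd hkk' (lt_irrefl _)
      | cast k => simpa using hβγ k b hb1.le hbθ
    | cast k' =>
      cases k using Fin.lastCases with
      | last => exact absurd (hkk'.trans (Fin.castSucc_lt_last k')) (lt_irrefl _)
      | cast k => simpa using hβ (Fin.castSucc_lt_castSucc_iff.1 hkk')
  · cases k using Fin.lastCases with
    | last => simpa using hγ b (g ξ) hb1.le (hg ξ hξ).1 (hg ξ hξ).2.1
    | cast k => simpa using hβγ k (g ξ) (hg1 ξ hξ) (hg ξ hξ).2.1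
  · cases k using Fin.lastCases with
    | last => simpa using ⟨hYF, hY⟩
    | cast k => simpa using hX k
  · rintro _ ⟨ξ, _, hξ, rfl⟩
    exact (mk_le_mk_of_subset (hW ξ hξ).1).trans (hZθ _ (hg1 ξ hξ) (hg ξ hξ).2.1).le
  · by_contra! hlt
    -- At the index `(succ u).ord` the tail set has at least `succ u` elements, so `u` is no upper
    -- bound.
    have hξ : (succ u).ord < θ.ord := ord_lt_ord.2 (hθ.isSuccLimit.succ_lt hlt)
    have h1 : 1 ≤ (succ u).ord := by
      rw [Order.one_le_iff_ne_zero, Ne, ord_eq_zero]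
      exact (succ_pos u).ne'
    have := (hW _ hξ).2.1.trans (hu ⟨_, h1, hξ, rfl⟩)
    rw [card_ord] at this
    exact this.not_gt (lt_succ u)
  · intro x hx
    rw [mem_winSet_iff] at hx
    obtain ⟨hxX, hxW, hxF, hxlt⟩ := hx
    have hxX' : ∀ (i : Fin s) (h : (i : ℕ) < e), x i ∈ incSeq (X ⟨i, h⟩) r := fun i h => by
      simpa [Fin.snoc, h] using hxX i (h.trans (Nat.lt_succ_self e))
    have hxY : ∀ i : Fin s, (i : ℕ) = e → x i ∈ incSeq Y r := fun i h => by
      simpa [Fin.snoc, h] using hxX i (h ▸ Nat.lt_succ_self _)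
    -- `F` is constant on a row and different `W ξ` have different ranks, so the first entry, which
    -- exists as `1 ≤ r`, decides `ξ`.
    have hxW' : ∀ i : Fin s, e + 1 ≤ i → ∃ ξ < θ.ord, ∀ j, x i j ∈ W ξ := fun i hi => by
      have hmem : ∀ j, ∃ ξ < θ.ord, x i j ∈ W ξ := fun j => by
        obtain ⟨ξ, hξ, hj⟩ := Set.mem_iUnion₂.1 ((hxW i hi).2 j)
        exact ⟨ξ, hξ.2, hj⟩
      obtain ⟨ξ, hξ, hj0⟩ := hmem ⟨0, hr⟩
      refine ⟨ξ, hξ, fun j => ?_⟩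
      obtain ⟨η, hη, hj⟩ := hmem j
      have heq : γ (g ξ) = γ (g η) := by
        rw [← show F (x i ⟨0, hr⟩) = γ (g ξ) from hWF ξ hξ hj0,
          ← show F (x i j) = γ (g η) from hWF η hη hj, hxF i hi]
      rcases lt_trichotomy ξ η with hlt | rfl | hlt
      · exact absurd heq (hγg ξ η hlt hη).ne
      · exact hj
      · exact absurd heq (hγg η ξ hlt hξ).ne'
    have hxS : x ∈ S := by
      refine hsub (mem_winSet_iff.2 ⟨hxX', fun i hi => ?_, fun i hi j l => ?_,
        fun i i' hi hii' j => ?_⟩)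
      · rcases hi.eq_or_lt with hi | hi
        · exact ⟨(hxY i hi.symm).1, fun j => Set.mem_iUnion₂.2 ⟨b, ⟨hb1.le, hbθ⟩,
            hYb (hYYb ((hxY i hi.symm).2 j))⟩⟩
        · obtain ⟨ξ, hξ, hj⟩ := hxW' i hi
          exact ⟨(hxW i hi).1, fun j => Set.mem_iUnion₂.2 ⟨g ξ, ⟨hg1 ξ hξ, (hg ξ hξ).2.1⟩,
            (hW ξ hξ).1 (hj j)⟩⟩
      · rcases hi.eq_or_lt with hi | hi
        · exact (hYF ((hxY i hi.symm).2 j)).trans (hYF ((hxY i hi.symm).2 l)).symm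
        · exact hxF i hi j l
      · rcases hi.eq_or_lt with hi | hi
        · obtain ⟨ξ, hξ, hj⟩ := hxW' i' (by have : (i : ℕ) < i' := hii'; omega)
          rw [show F (x i j) = γ b from hYF ((hxY i hi.symm).2 j),
            show F (x i' j) = γ (g ξ) from hWF ξ hξ (hj j)]
          exact hγ _ _ hb1.le (hg ξ hξ).1 (hg ξ hξ).2.1
        · exact hxlt i i' hi hii' j
    refine hf c x hxS (fun i h => (hxX' i h).2) fun i hi => ?_
    rcases hi.eq_or_lt with hi | hi
    · exact ⟨Yb, fun j => hYYb ((hxY i hi.symm).2 j), hYbc⟩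
    · obtain ⟨ξ, hξ, hj⟩ := hxW' i hi
      exact ⟨W ξ, hj, (hW ξ hξ).2.2⟩

theorem IsSuperlarge.of_isColourDetermined {θ : Cardinal.{w}} (hθ : θ.IsInaccessible)
    {F : M → Ordinal.{w}} (hF : ∀ β < θ.ord, #(F ⁻¹' {β}) < θ) {r s e : ℕ} (hr : 1 ≤ r)
    (hes : e < s) {S S' : Set (Fin s → Fin r → M)} (hS : IsSuperlarge θ F S e) (hSS' : S' ⊆ S)
    (hS' : IsColourDetermined θ S S' e) : IsSuperlarge θ F S' (e + 1) := by
  refine ⟨Nat.le_add_left 1 e, hes, hSS'.trans hS.subset, ?_⟩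
  obtain ⟨st, hst⟩ := hS.wins
  choose! b γ hbγ using fun (μ : Fin (e + 1) → Cardinal.{w}) (hμ : ∀ k, μ k < θ) =>
    (hst (fun k => μ k.castSucc) fun k => hμ _).snoc hθ hF hr hS' hμ
  let head : (k : Fin (e + 1)) → (Set.Iic k → Cardinal.{w}) → Ordinal.{w} :=
    Fin.lastCases (motive := fun k => (Set.Iic k → Cardinal.{w}) → Ordinal.{w})
      (fun m => b fun i => m ⟨i, Fin.le_last i⟩)
      fun k m => st.head k fun i => m ⟨i.1.castSucc, Fin.castSucc_le_castSucc_iff.2 i.2⟩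
  refine ⟨⟨head, γ⟩, fun μ hμ => ?_⟩
  convert hbγ μ hμ using 1
  ext k
  cases k using Fin.lastCases with
  | last => simp [head]
  | cast k => simp [head]

end Game

/-! ### Sentences of type (iv) -/

/-- Not every `v_k` need occur in `τ`, and the index bounds on constants cover only those that occur
in the sentence. -/
theorem realize_congr_varFinset {K : FirstOrder.Language} {M α : Type*} [K.Structure M]
    [DecidableEq α] {t : K.Term α} {v v' : α → M} (h : ∀ k ∈ t.varFinset, v k = v' k) :
    t.realize v = t.realize v' := by
  induction t with
  | var k => exact h k (by simp [FirstOrder.Language.Term.varFinset])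
  | func f ts ih =>
    simp only [FirstOrder.Language.Term.realize_func]
    congr 1
    ext i
    exact ih i fun k hk => h k (by
      simp only [FirstOrder.Language.Term.varFinset, Finset.mem_biUnion]
      exact ⟨i, Finset.mem_univ _, hk⟩)

theorem mem_varFinsetLeft_relabel {K : FirstOrder.Language} {α β γ : Type*} [DecidableEq α]
    [DecidableEq β] {t : K.Term α} (g : α → β) {k : α} (hk : k ∈ t.varFinset) :
    g k ∈ (t.relabel (Sum.inl ∘ g : α → β ⊕ γ)).varFinsetLeft := by
  induction t with
  | var k' =>
    obtain rfl : k = k' := by simpa [FirstOrder.Language.Term.varFinset] using hk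
    simp [FirstOrder.Language.Term.varFinsetLeft]
  | func f ts ih =>
    simp only [FirstOrder.Language.Term.varFinset, Finset.mem_biUnion] at hk
    obtain ⟨i, -, hk⟩ := hk
    simp only [FirstOrder.Language.Term.relabel, FirstOrder.Language.Term.varFinsetLeft,
      Finset.mem_biUnion]
    exact ⟨i, Finset.mem_univ _, ih i hk⟩

/-- This lets a colouring of unordered sets record term values: a set of entries can be assigned to
the variables in increasing order in only one way. -/
theorem eqOn_of_strictMonoOn_of_image_eq {ι α : Type*} [LinearOrder ι] [WellFoundedLT ι]
    [Preorder α] {K : Set ι} {g g' : ι → α} (hg : StrictMonoOn g K) (hg' : StrictMonoOn g' K)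
    (h : g '' K = g' '' K) : Set.EqOn g g' K := by
  have := (StrictMono.range_inj hg.domRestrict hg'.domRestrict).1
    (by rw [Set.range_domRestrict, Set.range_domRestrict, h])
  exact fun k hk => congrFun this ⟨k, hk⟩

namespace TypeIVData

variable {L : FirstOrder.Language.{u, u}} (d : TypeIVData L)

theorem mem_constantsIn_sentence (lt : L.Relations 2) {k : Fin (d.m + 1)}
    (hk : k ∈ d.τ.varFinset) :
    d.c k ∈ constantsIn (d.sentence lt) ∧ d.right k ∈ constantsIn (d.sentence lt) := by
  have h1 := mem_varFinsetLeft_relabel (γ := Fin 0) d.c hk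
  have h2 := mem_varFinsetLeft_relabel (γ := Fin 0) d.right hk
  simp only [constantsIn, sentence, Equiv.symm_apply_apply, FirstOrder.Language.Term.equal,
    FirstOrder.Language.Term.bdEqual, FirstOrder.Language.BoundedFormula.freeVarFinset,
    Finset.mem_union, FirstOrder.Language.Term.relabel_relabel]
  exact ⟨Or.inr (Or.inl h1), Or.inr (Or.inr h2)⟩

theorem bound_mem_constantsIn_sentence (lt : L.Relations 2) :
    (d.iota - 1, d.j) ∈ constantsIn (d.sentence lt) := by
  simp [constantsIn, sentence, FirstOrder.Language.BoundedFormula.freeVarFinset,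
    FirstOrder.Language.Relations.formula₂, FirstOrder.Language.Relations.formula,
    FirstOrder.Language.Relations.boundedFormula, FirstOrder.Language.Term.varFinsetLeft]

theorem satisfiesAt_sentence {lt : L.Relations 2} {M : Type w} [LinearOrder M]
    [(skolemLanguage L).Structure M]
    (hlt : ∀ a b : M, FirstOrder.Language.Structure.RelMap (relSymbol L lt) ![a, b] ↔ a < b)
    {r s : ℕ} {a : Fin s → Fin r → M} :
    SatisfiesAt (d.sentence lt) a ↔
      ∀ v : ℕ × ℕ → M, (∀ (i : Fin s) (j : Fin r), v (i + 1, j + 1) = a i j) →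
        d.τ.realize (v ∘ d.c) < v (d.iota - 1, d.j) →
        d.τ.realize (v ∘ d.c) = d.τ.realize (v ∘ d.right) := by
  refine forall₂_congr fun v _ => ?_
  let _ := FirstOrder.Language.constantsOn.structure v
  refine (FirstOrder.Language.Formula.realize_equivSentence M _).trans ?_
  rw [FirstOrder.Language.Formula.realize_imp, FirstOrder.Language.Formula.realize_rel₂,
    FirstOrder.Language.Formula.realize_equal, hlt]
  simp only [FirstOrder.Language.Term.realize_relabel, FirstOrder.Language.Term.realize_var]
  exact Iff.rfl

/-- The variables of the term that stand for constants of the last row. -/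
def topVars : Finset (Fin (d.m + 1)) := d.τ.varFinset.filter fun k => (d.c k).1 = d.iota

theorem mem_topVars {k : Fin (d.m + 1)} :
    k ∈ d.topVars ↔ k ∈ d.τ.varFinset ∧ (d.c k).1 = d.iota := Finset.mem_filter

/-- `b` is the value of the term when `t` is the set of values of the constants of its last row and
the other constants have the values given by `x`. -/
def IsValue {M : Type w} [LinearOrder M] [(skolemLanguage L).Structure M] (t : Finset M)
    (x : ℕ × ℕ → M) (b : M) : Prop :=
  ∃ g : Fin (d.m + 1) → M, StrictMonoOn g d.topVars ∧ g '' d.topVars = t ∧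
    d.τ.realize (fun k => if (d.c k).1 = d.iota then g k else x (d.c k)) = b

theorem fst_le_iota (k : Fin (d.m + 1)) : (d.c k).1 ≤ d.iota := by
  have h := d.c_increasing.monotone (Fin.le_last k)
  rcases (Prod.Lex.le_iff.1 h) with h | h
  · exact h.le
  · exact h.1.le

theorem snd_lt_snd {k k' : Fin (d.m + 1)} (hk : (d.c k).1 = d.iota) (hk' : (d.c k').1 = d.iota)
    (h : k < k') : (d.c k).2 < (d.c k').2 := by
  rcases Prod.Lex.lt_iff.1 (d.c_increasing h) with h | h
  · exact absurd (hk.trans hk'.symm) h.ne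
  · exact h.2

theorem right_eq {k : Fin (d.m + 1)} (hk : (d.c k).1 = d.iota) : d.right k = (d.u, d.l k) :=
  if_pos hk

theorem l_lt_l {k k' : Fin (d.m + 1)} (hk : (d.c k).1 = d.iota) (hk' : (d.c k').1 = d.iota)
    (h : k < k') : d.l k < d.l k' := by
  have := d.right_increasing h
  change toLex (d.right k) < toLex (d.right k') at this
  rw [d.right_eq hk, d.right_eq hk'] at this
  rcases Prod.Lex.lt_iff.1 this with h | h
  · exact absurd h (lt_irrefl _)
  · exact h.2

end TypeIVData

/-- Sentences of type (iv) with `ι = e + 1` hold at a matrix if its first `e` rows lie in given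
small sets and its other rows lie in suitable homogeneous sets of the same colour. -/
theorem isColourDetermined_satisfiesAt {L : FirstOrder.Language.{u, u}} {lt : L.Relations 2}
    {M : Type w} [LinearOrder M] [(skolemLanguage L).Structure M]
    (hlt : ∀ a b : M, FirstOrder.Language.Structure.RelMap (relSymbol L lt) ![a, b] ↔ a < b)
    {θ : Cardinal.{w}} (hθ : θ.IsInaccessible) (hM : IsThetaLike θ M) {r s e p : ℕ}
    {S : Set (Fin s → Fin r → M)} (hS : ∀ a ∈ S, ∀ i, StrictMono (a i)) (σ : Fin p → CSentence L)
    (hσ : ∀ k, IsTypeIV lt (σ k) (e + 1))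
    (hocc : ∀ k, ∀ c ∈ constantsIn (σ k), (1 ≤ c.1 ∧ c.1 ≤ s) ∧ (1 ≤ c.2 ∧ c.2 ≤ r)) :
    IsColourDetermined θ S {a | a ∈ S ∧ ∀ k, SatisfiesAt (σ k) a} e := by
  classical
  intro X hX
  choose d hd hde using hσ
  have : Nonempty M := mk_ne_zero_iff.1 (hM.1 ▸ hθ.ne_zero)
  let m₀ : M := Classical.arbitrary M
  set D : Set M := ⋃ k : ULift.{w} (Fin e), X k.down
  have hDθ : #D < θ := by
    refine (card_iUnion_lt_iff_forall_of_isRegular hθ.isRegular ?_).2 fun k => hX k.down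
    simpa using hθ.nat_lt e
  set B : Set M := ⋃ a ∈ D, Set.Iio a
  have hBθ : #B < θ :=
    (card_biUnion_lt_iff_forall_of_isRegular hθ.isRegular hDθ).2 fun a _ => hM.2 a
  -- `m₀` is a dummy value for constants whose value is not in `D`, so that assignments are total
  -- functions into a small set.
  let D' : Set M := insert m₀ D
  have hD'θ : #D' < θ := (mk_insert_le).trans_lt
    (add_lt_of_lt hθ.isRegular.aleph0_le hDθ (by simpa using hθ.nat_lt 1))
  refine ⟨Set (Fin p × (ℕ × ℕ → D') × B),
    fun t => {q | (d q.1).IsValue t (fun i => (q.2.1 i : M)) q.2.2},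
    ∑ k, (d k).topVars.card, ?_, fun c a haS hlow hhigh => ⟨haS, fun k => ?_⟩⟩
  · rw [mk_set]
    refine hθ.isStrongLimit.isStrongPrelimit ?_
    have hP : #(ℕ × ℕ → D') < θ := by
      rw [mk_arrow]
      simpa using power_lt_of_isInaccessible hθ hD'θ hθ.aleph0_lt
    have hPB := mul_lt_of_lt hθ.isRegular.aleph0_le hP hBθ
    simpa using mul_lt_of_lt hθ.isRegular.aleph0_le (hθ.nat_lt p) hPB
  rw [← hd k, (d k).satisfiesAt_sentence hlt]
  intro v hv hvlt
  have hva : ∀ i j, ∀ (hi : 1 ≤ i) (his : i ≤ s) (hj : 1 ≤ j) (hjr : j ≤ r),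
      v (i, j) = a ⟨i - 1, by omega⟩ ⟨j - 1, by omega⟩ := fun i j hi his hj hjr => by
    rw [← hv]
    simp only [Nat.sub_add_cancel hi, Nat.sub_add_cancel hj]
  have hvD : ∀ i j, 1 ≤ i → i ≤ s → 1 ≤ j → j ≤ r → i ≤ e → v (i, j) ∈ D :=
    fun i j hi his hj hjr hie => by
      rw [hva i j hi his hj hjr]
      exact Set.mem_iUnion.2 ⟨⟨⟨i - 1, by omega⟩⟩, hlow ⟨i - 1, by omega⟩ (by dsimp only; omega) _⟩
  have hrow : ∀ i j j', 1 ≤ i → i ≤ s → 1 ≤ j → j' ≤ r → j < j' → v (i, j) < v (i, j') :=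
    fun i j j' hi his hj hjr hjj' => by
      rw [hva i j hi his hj (by omega), hva i j' hi his (by omega) hjr]
      exact hS a haS _ (Fin.mk_lt_mk.2 (by omega))
  have hc := fun (l : Fin ((d k).m + 1)) (hl : l ∈ (d k).τ.varFinset) =>
    hocc k _ (hd k ▸ ((d k).mem_constantsIn_sentence lt hl).1)
  have hright := fun (l : Fin ((d k).m + 1)) (hl : l ∈ (d k).τ.varFinset) =>
    hocc k _ (hd k ▸ ((d k).mem_constantsIn_sentence lt hl).2)
  have hbound := hocc k _ (hd k ▸ (d k).bound_mem_constantsIn_sentence lt)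
  simp only [hde, Nat.add_sub_cancel] at hvlt hbound
  set b := (d k).τ.realize (v ∘ (d k).c)
  -- The bounding constant belongs to row `e`, whose entries lie in `D`.
  have hbB : b ∈ B := Set.mem_iUnion₂.2
    ⟨_, hvD e _ hbound.1.1 hbound.1.2 hbound.2.1 hbound.2.2 le_rfl, hvlt⟩
  let x : ℕ × ℕ → D' := fun i => if h : v i ∈ D then ⟨v i, Or.inr h⟩ else ⟨m₀, Or.inl rfl⟩
  have hx : ∀ l ∈ (d k).τ.varFinset, ((d k).c l).1 ≠ (d k).iota →
      (x ((d k).c l) : M) = v ((d k).c l) := fun l hl hne => by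
    have hle : ((d k).c l).1 ≤ e :=
      Nat.le_of_lt_succ (((d k).fst_le_iota l).lt_of_ne hne |>.trans_eq (hde k))
    have hmem : v ((d k).c l) ∈ D := hvD _ _ (hc l hl).1.1 (hc l hl).1.2 (hc l hl).2.1
      (hc l hl).2.2 hle
    simp only [x, dif_pos hmem]
  have hcolour : ∀ (i : ℕ) (t : Fin ((d k).m + 1) → ℕ), e + 1 ≤ i → i ≤ s →
      (∀ l ∈ (d k).topVars, 1 ≤ t l ∧ t l ≤ r) → StrictMonoOn t (d k).topVars →
      StrictMonoOn (fun l => v (i, t l)) (d k).topVars ∧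
      {q : Fin p × (ℕ × ℕ → D') × B | (d q.1).IsValue
        ((d k).topVars.image fun l => v (i, t l)) (fun i => (q.2.1 i : M)) q.2.2} =
        c (d k).topVars.card := fun i t hie his htr ht => by
    have hmono : StrictMonoOn (fun l => v (i, t l)) (d k).topVars := fun l hl l' hl' hll' =>
      hrow i _ _ (by omega) his (htr l hl).1 (htr l' hl').2 (ht hl hl' hll')
    refine ⟨hmono, ?_⟩
    obtain ⟨Y, hY, hYc⟩ := hhigh ⟨i - 1, by omega⟩ (by dsimp only; omega)
    refine hYc _ (Finset.single_le_sum (f := fun k => (d k).topVars.card)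
      (fun _ _ => Nat.zero_le _) (Finset.mem_univ k)) _ ?_ (Finset.card_image_of_injOn hmono.injOn)
    rw [Finset.coe_image]
    rintro _ ⟨l, hl, rfl⟩
    dsimp only
    rw [hva i (t l) (by omega) his (htr l hl).1 (htr l hl).2]
    exact hY _
  -- If no constant of the last row occurs, both sides are the same value. This case is separate
  -- because `u ≤ s` is known only when some `c_{ul}` occurs.
  rcases (d k).topVars.eq_empty_or_nonempty with hemp | ⟨l₀, hl₀⟩
  · refine realize_congr_varFinset fun l hl => ?_
    have hne : ((d k).c l).1 ≠ (d k).iota := fun h =>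
      Finset.notMem_empty l (hemp ▸ (d k).mem_topVars.2 ⟨hl, h⟩)
    simp [TypeIVData.right, hne]
  have hctop : ∀ l ∈ (d k).topVars, (d k).c l = (e + 1, ((d k).c l).2) := fun l hl =>
    Prod.ext (((d k).mem_topVars.1 hl).2.trans (hde k)) rfl
  have hrtop : ∀ l ∈ (d k).topVars, (d k).right l = ((d k).u, (d k).l l) := fun l hl =>
    (d k).right_eq ((d k).mem_topVars.1 hl).2
  have hτ : ∀ l ∈ (d k).topVars, l ∈ (d k).τ.varFinset := fun l hl => ((d k).mem_topVars.1 hl).1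
  have hiota : ∀ l ∈ (d k).topVars, ((d k).c l).1 = (d k).iota := fun l hl =>
    ((d k).mem_topVars.1 hl).2
  obtain ⟨hmono₁, hcol₁⟩ := hcolour (e + 1) (fun l => ((d k).c l).2) le_rfl
    ((congrArg Prod.fst (hctop l₀ hl₀)).symm.trans_le (hc l₀ (hτ l₀ hl₀)).1.2)
    (fun l hl => (hc l (hτ l hl)).2)
    fun l hl l' hl' => (d k).snd_lt_snd (hiota l hl) (hiota l' hl')
  obtain ⟨hmono₂, hcol₂⟩ := hcolour (d k).u (d k).l (hde k ▸ (d k).le_u)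
    (by simpa [hrtop l₀ hl₀] using (hright l₀ (hτ l₀ hl₀)).1.2)
    (fun l hl => by simpa [hrtop l hl] using (hright l (hτ l hl)).2)
    fun l hl l' hl' => (d k).l_lt_l (hiota l hl) (hiota l' hl')
  have hval : (k, x, ⟨b, hbB⟩) ∈ {q : Fin p × (ℕ × ℕ → D') × B | (d q.1).IsValue
      ((d k).topVars.image fun l => v (e + 1, ((d k).c l).2)) (fun i => (q.2.1 i : M)) q.2.2} := by
    refine ⟨_, hmono₁, (Finset.coe_image).symm, realize_congr_varFinset fun l hl => ?_⟩
    split_ifs with h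
    · exact congrArg v (hctop l ((d k).mem_topVars.2 ⟨hl, h⟩)).symm
    · exact hx l hl h
  -- Equality of the two colours transfers the value `b` from row `e + 1` to row `u`.
  rw [hcol₁, ← hcol₂] at hval
  obtain ⟨g, hg, himg, hgb⟩ := hval
  rw [Finset.coe_image] at himg
  have hgeq := eqOn_of_strictMonoOn_of_image_eq hg hmono₂ himg
  refine hgb.symm.trans (realize_congr_varFinset fun l hl => ?_)
  dsimp only [Function.comp]
  split_ifs with h
  · have hl' := (d k).mem_topVars.2 ⟨hl, h⟩
    rw [hgeq hl', hrtop l hl']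
  · rw [hx l hl h, TypeIVData.right, if_neg h]

/-- With a single colour every condition on colours is void, so a round can be added without
shrinking `S`. -/
theorem IsSuperlarge.of_le {M : Type w} [LinearOrder M] {θ : Cardinal.{w}}
    (hθ : θ.IsInaccessible) {F : M → Ordinal.{w}} (hF : ∀ β < θ.ord, #(F ⁻¹' {β}) < θ)
    {r s e e' : ℕ} (hr : 1 ≤ r) {S : Set (Fin s → Fin r → M)} (hS : IsSuperlarge θ F S e)
    (hee' : e ≤ e') (hes : e' ≤ s) : IsSuperlarge θ F S e' := by
  induction e', hee' using Nat.le_induction with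
  | base => exact hS
  | succ n _ ih =>
    refine (ih (Nat.le_of_succ_le hes)).of_isColourDetermined hθ hF hr hes subset_rfl fun _ _ =>
      ⟨PUnit, fun _ => PUnit.unit, 0, ?_, fun _ _ ha _ _ => ha⟩
    rw [mk_punit]
    exact_mod_cast hθ.nat_lt 1

end Superlarge

theorem proposition3p4
    {L : FirstOrder.Language.{u, u}} (hL : L.card ≤ ℵ₀) (lt : L.Relations 2)
    {M : Type w} [LinearOrder M] [(Superlarge.skolemLanguage L).Structure M]
    (hlt : ∀ a b : M, FirstOrder.Language.Structure.RelMap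
      (Superlarge.relSymbol L lt) ![a, b] ↔ a < b)
    (hskolem : FirstOrder.Language.Theory.Model M (Superlarge.skolemTheory L))
    {θ : Cardinal.{w}} (hθ : θ.IsInaccessible) (hM : Superlarge.IsThetaLike θ M)
    (N : Ordinal.{w} → (Superlarge.skolemLanguage L).ElementarySubstructure M)
    (hN : Superlarge.IsElementaryEndChain θ N)
    {r s e e' p : ℕ} (hr : 1 ≤ r) (hes : e < s) (hee' : e < e') (he's : e' ≤ s)
    (S : Set (Fin s → Fin r → M))
    (hS : Superlarge.IsSuperlarge θ (Superlarge.rankFn θ N) S e)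
    (σ : Fin p → Superlarge.CSentence L)
    (hσ : ∀ k, Superlarge.IsTypeIV lt (σ k) e')
    (hocc : ∀ k, ∀ c ∈ Superlarge.constantsIn (σ k), (1 ≤ c.1 ∧ c.1 ≤ s) ∧ (1 ≤ c.2 ∧ c.2 ≤ r)) :
    ∃ S' ⊆ S, Superlarge.IsSuperlarge θ (Superlarge.rankFn θ N) S' e' ∧
      ∀ a ∈ S', ∀ k, Superlarge.SatisfiesAt (σ k) a := by
  have hF : ∀ β < θ.ord, #(Superlarge.rankFn θ N ⁻¹' {β}) < θ := fun _ hβ =>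
    Superlarge.mk_fibre_lt hθ hM hN hS hβ
  obtain ⟨n, rfl⟩ : ∃ n, e' = n + 1 := ⟨e' - 1, by omega⟩
  -- The row that bounds the term value is row `n`, so the first `n` rows must be confined before
  -- the colouring is formed.
  have hSn := hS.of_le hθ hF hr (Nat.le_of_lt_succ hee') (Nat.le_of_succ_le he's)
  refine ⟨{a | a ∈ S ∧ ∀ k, Superlarge.SatisfiesAt (σ k) a}, fun a ha => ha.1, ?_,
    fun a ha => ha.2⟩
  exact hSn.of_isColourDetermined hθ hF hr he's (fun a ha => ha.1)
    (Superlarge.isColourDetermined_satisfiesAt hlt hθ hM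
      (fun a ha i => ((hS.subset ha).1 i).1) σ hσ hocc)
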